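/- A domain is a nonempty connected open set $G\subset\mathbb C^n$; $\mathcal O(G)$ denotes the space of holomorphic functions on $G$. The domain $G$ is called $n$-circled if $(e^{i\theta_1}z_1,\dots,e^{i\theta_n}z_n)\in G$ for all $(z_1,\dots,z_n)\in G$ and $(\theta_1,\dots,\theta_n)\in\mathbb R^n$, and fat if $G=\operatorname{int}\overline G$. For a family $\mathcal F\subset\mathcal O(G)$, $G$ is called an $\mathcal F$-domain of holomorphy if there are no domains $G_0,\widetilde G\subset\mathbb C^n$ with $\varnothing\ne G_0\subset G\cap\widetilde G$ and $\widetilde G\not\subset G$ such that for every $f\in\mathcal F$ there is $\widetilde f\in\mathcal O(\widetilde G)$ with $\widetilde f=f$ on $G_0$; a domain of holomorphy is an $\mathcal O(G)$-domain of holomorphy. For an integer $k\ge 0$ let $\mathcal A^k(G)$ be the set of all $f\in\mathcal O(G)$ such that for every multi-index $\nu\in(\mathbb Z_{\ge0})^n$ with $|\nu|\le k$ the derivative $\partial^\nu f=\frac{\partial^{|\nu|}f}{\partial z_1^{\nu_1}\cdots\partial z_n^{\nu_n}}$ extends continuously to $\overline G$. Let $G\subset\mathbb C^n$ be a bounded fat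 $n$-circled domain of holomorphy. Then, for every integer $k\ge0$, $G$ is an $\mathcal A^k(G)$-domain of holomorphy. -/

import Mathlib

namespace CircledDomains

/-- A domain in `ℂⁿ`: a nonempty connected open set. -/
def IsRegion {n : ℕ} (G : Set (Fin n → ℂ)) : Prop :=
  IsOpen G ∧ IsConnected G

/-- `𝒪(G)`: the functions holomorphic on the open set `G`. Functions are total; their values
outside `G` are irrelevant. -/
def holomorphicFunctions {n : ℕ} (G : Set (Fin n → ℂ)) : Set ((Fin n → ℂ) → ℂ) :=
  {f | DifferentiableOn ℂ f G}

/-- The complex partial derivative `∂f/∂z_j`. -/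
noncomputable def partialDeriv {n : ℕ} (j : Fin n) (f : (Fin n → ℂ) → ℂ) :
    (Fin n → ℂ) → ℂ :=
  fun z => lineDeriv ℂ f z (Pi.single j 1)

/-- The mixed partial derivative `∂^ν f = ∂₁^{ν₁} ⋯ ∂ₙ^{νₙ} f` for a multi-index `ν`. -/
noncomputable def multiPartialDeriv {n : ℕ} (ν : Fin n → ℕ) (f : (Fin n → ℂ) → ℂ) :
    (Fin n → ℂ) → ℂ :=
  (List.finRange n).foldr (fun j g => (partialDeriv j)^[ν j] g) f

/-- `𝒜^k(G)`: the functions holomorphic on `G` all of whose partial derivatives of order at most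
`k` extend continuously to the closure of `G`. -/
def spaceA {n : ℕ} (k : ℕ) (G : Set (Fin n → ℂ)) : Set ((Fin n → ℂ) → ℂ) :=
  {f | f ∈ holomorphicFunctions G ∧
    ∀ ν : Fin n → ℕ, ∑ j, ν j ≤ k →
      ∃ fν : (Fin n → ℂ) → ℂ, ContinuousOn fν (closure G) ∧ Set.EqOn fν (multiPartialDeriv ν f) G}

/-- `G` is an `ℱ`-domain of holomorphy, for a family `ℱ` of functions holomorphic on `G`: `G` is
a domain and there are no domains `G₀, G'` with `G₀ ⊆ G ∩ G'` and `G' ⊄ G` such that every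
`f ∈ ℱ` admits a function holomorphic on `G'` which equals `f` on `G₀`. -/
def IsDomainOfHolomorphyFor {n : ℕ} (F : Set ((Fin n → ℂ) → ℂ)) (G : Set (Fin n → ℂ)) : Prop :=
  IsRegion G ∧
    ¬ ∃ G₀ G' : Set (Fin n → ℂ), IsRegion G₀ ∧ IsRegion G' ∧ G₀ ⊆ G ∩ G' ∧ ¬ G' ⊆ G ∧
      ∀ f ∈ F, ∃ f' ∈ holomorphicFunctions G', Set.EqOn f' f G₀

/-- A domain of holomorphy is an `𝒪(G)`-domain of holomorphy. -/
def IsDomainOfHolomorphy {n : ℕ} (G : Set (Fin n → ℂ)) : Prop :=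
  IsDomainOfHolomorphyFor (holomorphicFunctions G) G

/-- `G` is `n`-circled: invariant under `(z₁, …, zₙ) ↦ (e^{iθ₁}z₁, …, e^{iθₙ}zₙ)`. -/
def IsCircled {n : ℕ} (G : Set (Fin n → ℂ)) : Prop :=
  ∀ z ∈ G, ∀ θ : Fin n → ℝ, (fun j => Complex.exp (Complex.I * (θ j : ℂ)) * z j) ∈ G

/-- `G` is fat: it is the interior of its closure. -/
def IsFat {n : ℕ} (G : Set (Fin n → ℂ)) : Prop :=
  G = interior (closure G)

end CircledDomains

/-!
By Abel's lemma, the Laurent series of a holomorphic function on a circled domain `G` converges over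
the whole convex hull of the logarithmic image `{(log |z₁|, …, log |zₙ|) | z ∈ G}`, enlarged in the
negative directions of the coordinates which vanish somewhere on `G`. Hence, if `G` is a domain of
holomorphy, this image is convex and invariant under those directions.

Let `G' ⊄ G` be a domain. As `G` is fat, `G'` contains a point `z₀ ∉ closure G` without vanishing
coordinates. A hyperplane separates the logarithm of `z₀` from the logarithmic image; a large
multiple of its normal vector, rounded up to integers and increased by `k + 1`, is the exponent of a
monomial `z ^ α` which is `k` times differentiable up to the boundary of the bounded domain `G` and
satisfies `sup_G |z ^ α| < |z₀ ^ α|`. The function `1 / (z ^ α - z₀ ^ α)` then belongs to `𝒜^k(G)`,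
but its pole at `z₀` prevents it from extending to `G'`.
-/

namespace CircledDomains

open Filter Topology Metric Set MeasureTheory

section Holomorphic

variable {E F : Type*} [NormedAddCommGroup E] [NormedSpace ℂ E] [NormedAddCommGroup F]
  [NormedSpace ℂ F]

theorem norm_fderiv_le_of_forall_norm_le {f : E → F} {c : E} {r M : ℝ} (hr : 0 < r)
    (hf : DifferentiableOn ℂ f (ball c r)) (hM : ∀ z ∈ ball c r, ‖f z‖ ≤ M) :
    ‖fderiv ℂ f c‖ ≤ 2 * M / r := by
  refine Complex.norm_fderiv_le_div_of_mapsTo_ball hf (fun z hz => ?_) hr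
  rw [mem_closedBall, dist_eq_norm]
  calc ‖f z - f c‖ ≤ ‖f z‖ + ‖f c‖ := norm_sub_le _ _
    _ ≤ 2 * M := by linarith [hM z hz, hM c (mem_ball_self hr)]

theorem eqOn_of_convex_of_eventuallyEq [CompleteSpace F] {U : Set E} {f g : E → F} {b : E}
    (hU : IsOpen U) (hUc : Convex ℝ U) (hf : DifferentiableOn ℂ f U)
    (hg : DifferentiableOn ℂ g U) (hb : b ∈ U) (hfg : f =ᶠ[𝓝 b] g) : EqOn f g U := by
  intro c hc
  let line : ℂ →ᵃ[ℝ] E :=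
    ((LinearMap.toSpanSingleton ℂ E (c - b)).restrictScalars ℝ).toAffineMap + AffineMap.const ℝ ℂ b
  have line_apply (t : ℂ) : line t = t • (c - b) + b := rfl
  have hline : Differentiable ℂ line := by
    change Differentiable ℂ fun t : ℂ => t • (c - b) + b
    fun_prop
  have h0 : line 0 = b := by simp [line_apply]
  have h1 : line 1 = c := by simp [line_apply]
  have hopen : IsOpen (line ⁻¹' U) := hU.preimage hline.continuous
  have hanalytic {h : E → F} (hh : DifferentiableOn ℂ h U) :
      AnalyticOnNhd ℂ (h ∘ line) (line ⁻¹' U) :=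
    (hh.comp hline.differentiableOn fun _ ht => ht).analyticOnNhd hopen
  have heq : f ∘ line =ᶠ[𝓝 0] g ∘ line :=
    (hline.continuous.tendsto' 0 b h0).eventually hfg
  have := (hanalytic hf).eqOn_of_preconnected_of_eventuallyEq (hanalytic hg)
    (hUc.affine_preimage line).isPreconnected (by simpa only [mem_preimage, h0]) heq
    (show (1 : ℂ) ∈ line ⁻¹' U by simpa only [mem_preimage, h1])
  simpa only [Function.comp_apply, h1] using this

theorem eqOn_of_preconnected_of_eventuallyEq [CompleteSpace F] {U : Set E} {f g : E → F} {b : E}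
    (hU : IsOpen U) (hUc : IsPreconnected U) (hf : DifferentiableOn ℂ f U)
    (hg : DifferentiableOn ℂ g U) (hb : b ∈ U) (hfg : f =ᶠ[𝓝 b] g) : EqOn f g U := by
  suffices U ⊆ {z | f =ᶠ[𝓝 z] g} from fun z hz => (this hz).eq_of_nhds
  refine hUc.subset_of_closure_inter_subset isOpen_setOfPred_eventually_nhds ⟨b, hb, hfg⟩ ?_
  rintro a ⟨ha, haU⟩
  obtain ⟨r, hr, hrU⟩ := Metric.isOpen_iff.1 hU a haU
  obtain ⟨c, hc, hcr⟩ := Metric.mem_closure_iff.1 ha r hr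
  have := eqOn_of_convex_of_eventuallyEq isOpen_ball (convex_ball a r) (hf.mono hrU)
    (hg.mono hrU) (mem_ball'.2 hcr) hc
  exact this.eventuallyEq_of_mem (ball_mem_nhds a hr)

theorem differentiableOn_tsum_of_summable_norm [CompleteSpace F] {ι : Type*} {U : Set E}
    {f : ι → E → F} {u : ι → ℝ} (hu : Summable u) (hU : IsOpen U)
    (hf : ∀ i, DifferentiableOn ℂ (f i) U) (hfu : ∀ i, ∀ z ∈ U, ‖f i z‖ ≤ u i) :
    DifferentiableOn ℂ (fun z => ∑' i, f i z) U := by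
  intro c hc
  obtain ⟨r, hr, hrU⟩ := Metric.isOpen_iff.1 hU c hc
  have hsub : ∀ x ∈ ball c (r / 2), ball x (r / 2) ⊆ U := fun x hx =>
    (ball_subset_ball' (by linarith [mem_ball.1 hx])).trans hrU
  have hcr : c ∈ ball c (r / 2) := mem_ball_self (by positivity)
  refine (hasFDerivAt_tsum_of_isPreconnected (f' := fun i x => fderiv ℂ (f i) x)
    (u := fun i => 2 * u i / (r / 2)) ((hu.mul_left 2).div_const _) isOpen_ball
    (convex_ball c (r / 2)).isPreconnected (fun i x hx => ?_) (fun i x hx => ?_) hcr ?_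
    hcr).differentiableAt.differentiableWithinAt
  · exact ((hf i).differentiableAt
      (hU.mem_nhds (hsub x hx (mem_ball_self (by positivity))))).hasFDerivAt
  · exact norm_fderiv_le_of_forall_norm_le (by positivity) ((hf i).mono (hsub x hx))
      fun z hz => hfu i z (hsub x hx hz)
  · exact Summable.of_norm_bounded hu fun i => hfu i c hc

section Integral

variable [ProperSpace E] {X : Type*} [TopologicalSpace X] {U : Set E} {f : E → X → F}

theorem continuous_fderiv_of_continuousOn_uncurry (hU : IsOpen U)
    (hf : ContinuousOn (Function.uncurry f) (U ×ˢ univ))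
    (hd : ∀ t, DifferentiableOn ℂ (f · t) U) {c : E} (hc : c ∈ U) :
    Continuous fun t => fderiv ℂ (f · t) c := by
  obtain ⟨r, hr, hrU⟩ := Metric.nhds_basis_closedBall.mem_iff.1 (hU.mem_nhds hc)
  refine continuous_iff_continuousAt.2 fun s => Metric.tendsto_nhds.2 fun ε hε => ?_
  have hcont : ContinuousOn (Function.uncurry fun t z => f z t) (univ ×ˢ closedBall c r) :=
    hf.comp continuous_swap.continuousOn fun p hp => ⟨hrU hp.2, hp.1⟩
  obtain ⟨v, hv, hclose⟩ := (isCompact_closedBall c r).mem_uniformity_of_prod hcont (mem_univ s)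
    (Metric.dist_mem_uniformity (show 0 < ε * r / 4 by positivity))
  rw [nhdsWithin_univ] at hv
  filter_upwards [hv] with t ht
  have hdiff (t : X) : DifferentiableAt ℂ (f · t) c := (hd t).differentiableAt (hU.mem_nhds hc)
  have hball : ball c r ⊆ U := ball_subset_closedBall.trans hrU
  have hle := norm_fderiv_le_of_forall_norm_le (f := fun z => f z t - f z s) (M := ε * r / 4) hr
    (((hd t).sub (hd s)).mono hball) fun z hz => by
      rw [← dist_eq_norm]
      exact (hclose t ht z (ball_subset_closedBall hz)).le
  rw [fderiv_fun_sub (hdiff t) (hdiff s), ← dist_eq_norm] at hle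
  calc dist (fderiv ℂ (f · t) c) (fderiv ℂ (f · s) c) ≤ 2 * (ε * r / 4) / r := hle
    _ = ε / 2 := by field_simp; norm_num
    _ < ε := half_lt_self hε

theorem aestronglyMeasurable_of_continuous {H : Type*} [NormedAddCommGroup H] [CompactSpace X]
    [MeasurableSpace X] [OpensMeasurableSpace X] {μ : Measure X} {h : X → H} (hh : Continuous h) :
    AEStronglyMeasurable h μ := by
  simpa only [Measure.restrict_univ] using
    hh.continuousOn.aestronglyMeasurable_of_isCompact isCompact_univ MeasurableSet.univ

theorem differentiableOn_integral_of_continuousOn_uncurry [CompactSpace X] [MeasurableSpace X]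
    [OpensMeasurableSpace X] {μ : Measure X} [IsFiniteMeasure μ] (hU : IsOpen U)
    (hf : ContinuousOn (Function.uncurry f) (U ×ˢ univ))
    (hd : ∀ t, DifferentiableOn ℂ (f · t) U) :
    DifferentiableOn ℂ (fun z => ∫ t, f z t ∂μ) U := by
  intro c hc
  obtain ⟨r, hr, hrU⟩ := Metric.nhds_basis_closedBall.mem_iff.1 (hU.mem_nhds hc)
  obtain ⟨M, hM⟩ := ((isCompact_closedBall c r).prod isCompact_univ).exists_bound_of_continuousOn
    (hf.mono (prod_mono_left hrU))
  have hball : ball c (r / 2) ∈ 𝓝 c := ball_mem_nhds c (by positivity)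
  have hsub : ∀ x ∈ ball c (r / 2), ball x (r / 2) ⊆ closedBall c r := fun x hx =>
    (ball_subset_ball' (by linarith [mem_ball.1 hx])).trans ball_subset_closedBall
  have hballU : ∀ x ∈ ball c (r / 2), x ∈ U := fun x hx =>
    hrU (hsub x hx (mem_ball_self (by positivity)))
  have hcont {x : E} (hx : x ∈ U) : Continuous (f x) :=
    hf.comp_continuous (by fun_prop : Continuous fun t => (x, t)) fun t => ⟨hx, mem_univ t⟩
  refine (hasFDerivAt_integral_of_dominated_of_fderiv_le (𝕜 := ℂ)
    (F' := fun x t => fderiv ℂ (f · t) x) (bound := fun _ => 2 * M / (r / 2)) hball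
    ?_ ?_ (aestronglyMeasurable_of_continuous ?_) ?_ (integrable_const _)
    ?_).differentiableAt.differentiableWithinAt
  · filter_upwards [hball] with x hx
    exact aestronglyMeasurable_of_continuous (hcont (hballU x hx))
  · exact (integrable_const M).mono' (aestronglyMeasurable_of_continuous (hcont hc))
      (.of_forall fun t => hM (c, t) ⟨mem_closedBall_self hr.le, mem_univ t⟩)
  · exact continuous_fderiv_of_continuousOn_uncurry hU hf hd hc
  · refine .of_forall fun t x hx => norm_fderiv_le_of_forall_norm_le (by positivity)
      ((hd t).mono ((hsub x hx).trans hrU)) fun z hz => hM (z, t) ⟨hsub x hx hz, mem_univ t⟩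
  · exact .of_forall fun t x hx => ((hd t).differentiableAt
      (hU.mem_nhds (hballU x hx))).hasFDerivAt

end Integral

end Holomorphic

section LogNorm

variable {ι : Type*}

/-- The vector of the `log |z_j|`, in which monomials become exponentials of linear forms. It is
only meaningful for `z` without vanishing coordinates, because `Real.log 0 = 0`. -/
noncomputable def logNorm (z : ι → ℂ) : ι → ℝ := fun j => Real.log ‖z j‖

theorem continuousAt_logNorm {z : ι → ℂ} (hz : ∀ j, z j ≠ 0) : ContinuousAt logNorm z :=
  continuousAt_pi.2 fun j =>
    (continuous_apply j).continuousAt.norm.log (norm_ne_zero_iff.2 (hz j))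

theorem eventually_forall_ne_zero [Finite ι] {z : ι → ℂ} (hz : ∀ j, z j ≠ 0) :
    ∀ᶠ w in 𝓝 z, ∀ j, w j ≠ 0 :=
  eventually_all.2 fun j => (continuous_apply j).continuousAt.eventually_ne (hz j)

theorem exists_mem_forall_ne_zero {U : Set (ι → ℂ)} (hU : IsOpen U) (hne : U.Nonempty) :
    ∃ p ∈ U, ∀ j, p j ≠ 0 := by
  have hdense : Dense (univ.pi fun _ : ι => ({0}ᶜ : Set ℂ)) :=
    dense_pi _ fun _ _ => dense_compl_singleton 0
  obtain ⟨p, hp, hpU⟩ := hdense.inter_open_nonempty U hU hne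
  exact ⟨p, hp, fun j => hpU j trivial⟩

end LogNorm

noncomputable section Monomial

variable {ι : Type*} [Fintype ι] {α β : ι → ℤ} {z : ι → ℂ}

/-- The Laurent monomial `z ^ α` for a multi-exponent `α`, possibly with negative entries; these
are the terms of the Laurent series of functions on circled domains. -/
def zmonomial (α : ι → ℤ) (z : ι → ℂ) : ℂ := ∏ j, z j ^ α j

theorem zmonomial_add (hz : ∀ j, z j ≠ 0) :
    zmonomial (α + β) z = zmonomial α z * zmonomial β z := by
  simp only [zmonomial, ← Finset.prod_mul_distrib, Pi.add_apply, zpow_add₀ (hz _)]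

theorem zmonomial_ne_zero (h : ∀ j, z j ≠ 0 ∨ α j = 0) : zmonomial α z ≠ 0 := by
  refine Finset.prod_ne_zero_iff.2 fun j _ => ?_
  rcases h j with hz | hα
  · exact zpow_ne_zero _ hz
  · simp only [hα, zpow_zero, ne_eq, one_ne_zero, not_false_eq_true]

theorem zmonomial_eq_zero {j : ι} (hz : z j = 0) (hα : α j ≠ 0) : zmonomial α z = 0 :=
  Finset.prod_eq_zero (Finset.mem_univ j) (by rw [hz, zero_zpow _ hα])

theorem mul_zmonomial_negPart (hz : ∀ j, z j ≠ 0) :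
    zmonomial α z * zmonomial α⁻ z = zmonomial α⁺ z := by
  rw [← zmonomial_add hz, ← sub_eq_iff_eq_add.1 (posPart_sub_negPart α)]

theorem norm_zmonomial (hz : ∀ j, z j ≠ 0) :
    ‖zmonomial α z‖ = Real.exp (∑ j, α j * logNorm z j) := by
  rw [zmonomial, norm_prod, Real.exp_sum]
  refine Finset.prod_congr rfl fun j _ => ?_
  rw [norm_zpow, mul_comm, Real.exp_mul, logNorm, Real.exp_log (norm_pos_iff.2 (hz j)),
    Real.rpow_intCast]

theorem differentiableAt_zmonomial (h : ∀ j, z j ≠ 0 ∨ 0 ≤ α j) :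
    DifferentiableAt ℂ (zmonomial α) z := by
  classical
  have hfactor (j : ι) : DifferentiableAt ℂ (fun z : ι → ℂ => z j ^ α j) z :=
    (differentiableAt_apply j z).zpow (h j)
  exact (HasFDerivAt.finsetProd fun j _ => (hfactor j).hasFDerivAt).differentiableAt

end Monomial

/-- The coordinates which vanish somewhere on `G`; there, the Laurent series of a function on a
circled domain `G` contains no negative powers. -/
def vanishingCoords {ι : Type*} (G : Set (ι → ℂ)) : Set ι := {j | ∃ z ∈ G, z j = 0}

noncomputable section Torus

open UnitAddTorus

/-- The normalized Haar measure on the circle, as in `Mathlib.Analysis.Fourier.AddCircleMulti`. -/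
local instance : MeasureSpace UnitAddCircle := ⟨AddCircle.haarAddCircle⟩

local instance : Measure.IsAddHaarMeasure (volume : Measure UnitAddCircle) :=
  inferInstanceAs (Measure.IsAddHaarMeasure AddCircle.haarAddCircle)

local instance : IsProbabilityMeasure (volume : Measure UnitAddCircle) :=
  inferInstanceAs (IsProbabilityMeasure AddCircle.haarAddCircle)

section Rotate

variable {ι : Type*}

/-- The action of the torus on the coordinates by rotations, whose orbits in `ℂⁿ` are the sets of
points with prescribed moduli of the coordinates. -/
def rotate (t : UnitAddTorus ι) (z : ι → ℂ) : ι → ℂ := fun j => (t j).toCircle * z j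

theorem rotate_zero (z : ι → ℂ) : rotate 0 z = z := by
  ext j
  simp [rotate]

theorem rotate_rotate (s t : UnitAddTorus ι) (z : ι → ℂ) :
    rotate s (rotate t z) = rotate (s + t) z := by
  ext j
  simp only [rotate, Pi.add_apply, AddCircle.toCircle_add, Circle.coe_mul, mul_assoc]

theorem exists_rotate_eq {z w : ι → ℂ} (h : ∀ j, ‖w j‖ = ‖z j‖) : ∃ t, rotate t z = w := by
  refine ⟨fun j => (((w j).arg - (z j).arg) / (2 * Real.pi) : ℝ), funext fun j => ?_⟩
  calc _ = Complex.exp (((w j).arg - (z j).arg) * Complex.I) * z j := by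
        simp only [rotate, AddCircle.toCircle_apply_mk, Circle.coe_exp]
        push_cast
        congr 3
        field_simp
    _ = Complex.exp (((w j).arg - (z j).arg) * Complex.I) *
        (‖z j‖ * Complex.exp ((z j).arg * Complex.I)) := by rw [Complex.norm_mul_exp_arg_mul_I]
    _ = ‖w j‖ * Complex.exp ((w j).arg * Complex.I) := by
        rw [h, mul_left_comm, ← Complex.exp_add]
        ring_nf
    _ = w j := Complex.norm_mul_exp_arg_mul_I _

theorem continuous_rotate : Continuous fun p : UnitAddTorus ι × (ι → ℂ) => rotate p.1 p.2 := by
  unfold rotate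
  fun_prop

theorem differentiable_rotate [Finite ι] (t : UnitAddTorus ι) : Differentiable ℂ (rotate t) := by
  cases nonempty_fintype ι
  unfold rotate
  fun_prop

theorem zmonomial_rotate [Fintype ι] (α : ι → ℤ) (t : UnitAddTorus ι) (z : ι → ℂ) :
    zmonomial α (rotate t z) = mFourier α t * zmonomial α z := by
  simp only [zmonomial, rotate, mul_zpow, Finset.prod_mul_distrib, mFourier, ContinuousMap.coe_mk,
    fourier_apply, AddCircle.toCircle_zsmul, Circle.coe_zpow]

end Rotate

section LaurentPart

variable {ι : Type*} [Fintype ι]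

/-- The component of `f` that is homogeneous of multidegree `α` under rotations: the Fourier
coefficient of `f` on the torus orbits, which is the term of degree `α` of the Laurent series. -/
def laurentPart (f : (ι → ℂ) → ℂ) (α : ι → ℤ) (w : ι → ℂ) : ℂ :=
  mFourierCoeff (fun t => f (rotate t w)) α

theorem laurentPart_rotate (f : (ι → ℂ) → ℂ) (α : ι → ℤ) (s : UnitAddTorus ι) (w : ι → ℂ) :
    laurentPart f α (rotate s w) = mFourier α s * laurentPart f α w := by
  have hchar (t : UnitAddTorus ι) :
      mFourier (-α) t = mFourier α s * mFourier (-α) (t + s) := by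
    have hadd := zmonomial_rotate (-α) t (rotate s 1)
    rw [rotate_rotate, zmonomial_rotate, zmonomial_rotate] at hadd
    have hinv : mFourier α s * mFourier (-α) s = 1 := by
      rw [← mFourier_add, add_neg_cancel, mFourier_zero, ContinuousMap.one_apply]
    have hone : zmonomial (-α) (1 : ι → ℂ) = 1 := by simp [zmonomial]
    rw [hone, mul_one, mul_one] at hadd
    rw [hadd, mul_left_comm, hinv, mul_one]
  calc laurentPart f α (rotate s w)
      = ∫ t, mFourier α s * (mFourier (-α) (t + s) • f (rotate (t + s) w)) := by
        simp only [laurentPart, mFourierCoeff, rotate_rotate, smul_eq_mul, ← mul_assoc, ← hchar]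
    _ = mFourier α s * laurentPart f α w := by
        rw [integral_const_mul, integral_add_right_eq_self
          (fun t => mFourier (-α) t • f (rotate t w)), laurentPart, mFourierCoeff]

theorem norm_laurentPart_le {f : (ι → ℂ) → ℂ} {M : ℝ} {w : ι → ℂ}
    (hM : ∀ t, ‖f (rotate t w)‖ ≤ M) (α : ι → ℤ) : ‖laurentPart f α w‖ ≤ M := by
  have hle (t : UnitAddTorus ι) : ‖mFourier (-α) t • f (rotate t w)‖ ≤ M := by
    calc _ ≤ 1 * ‖f (rotate t w)‖ := by
          rw [norm_smul]
          gcongr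
          exact (ContinuousMap.norm_coe_le_norm _ t).trans mFourier_norm.le
      _ ≤ M := by simpa only [one_mul] using hM t
  simpa [laurentPart, mFourierCoeff] using
    norm_integral_le_of_norm_le_const (μ := (volume : Measure (UnitAddTorus ι))) (.of_forall hle)

theorem hasSum_laurentPart {f : (ι → ℂ) → ℂ} {w : ι → ℂ}
    (hf : Continuous fun t => f (rotate t w)) (hs : Summable fun α => laurentPart f α w) :
    HasSum (fun α => laurentPart f α w) (f w) := by
  have hzero (α : ι → ℤ) : mFourier α (0 : UnitAddTorus ι) = 1 := by simp [mFourier]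
  simpa [hzero, rotate_zero, laurentPart] using
    hasSum_mFourier_series_apply_of_summable (f := ⟨_, hf⟩) hs 0

theorem differentiableOn_laurentPart {U : Set (ι → ℂ)} {f : (ι → ℂ) → ℂ} (hU : IsOpen U)
    (hrot : ∀ z ∈ U, ∀ t, rotate t z ∈ U) (hf : DifferentiableOn ℂ f U) (α : ι → ℤ) :
    DifferentiableOn ℂ (laurentPart f α) U := by
  refine differentiableOn_integral_of_continuousOn_uncurry
    (f := fun z t => mFourier (-α) t • f (rotate t z)) hU ?_ fun t => ?_
  · have hcont : ContinuousOn (fun p : (ι → ℂ) × UnitAddTorus ι => f (rotate p.2 p.1))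
        (U ×ˢ univ) :=
      hf.continuousOn.comp (continuous_rotate.comp continuous_swap).continuousOn
        fun p hp => hrot p.1 hp.1 p.2
    exact ((mFourier (-α)).continuous.comp continuous_snd).continuousOn.smul hcont
  · exact (hf.comp (differentiable_rotate t).differentiableOn
      fun z hz => hrot z hz t).const_smul (mFourier (-α) t)

end LaurentPart

/-- Differentiate along the curves `s ↦ (exp (i v_j s) w_j)`, on which `f` is constant. -/
theorem fderiv_eq_zero_of_forall_norm_eq {ι : Type*} [Finite ι] {f : (ι → ℂ) → ℂ} {w : ι → ℂ}
    (hf : DifferentiableAt ℂ f w) (hw : ∀ j, w j ≠ 0)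
    (hinv : ∀ z, (∀ j, ‖z j‖ = ‖w j‖) → f z = f w) : fderiv ℂ f w = 0 := by
  cases nonempty_fintype ι
  have hreal (v : ι → ℝ) : fderiv ℂ f w (fun j => v j * Complex.I * w j) = 0 := by
    let curve : ℝ → ι → ℂ := fun s j => Complex.exp ((s * v j : ℝ) * Complex.I) * w j
    have hcurve0 : curve 0 = w := by simp [curve]
    have hcurve : HasDerivAt curve (fun j => v j * Complex.I * w j) 0 := by
      refine hasDerivAt_pi.2 fun j => ?_
      have := ((((hasDerivAt_id (0 : ℝ)).mul_const (v j)).ofReal_comp.mul_const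
        Complex.I).cexp.mul_const (w j))
      simpa [curve] using this
    have hconst : f ∘ curve = fun _ => f w := by
      funext s
      exact hinv _ fun j => by simp only [curve, norm_mul, Complex.norm_exp_ofReal_mul_I, one_mul]
    have hcomp := (hcurve0 ▸ hf.hasFDerivAt.restrictScalars ℝ :
      HasFDerivAt f ((fderiv ℂ f w).restrictScalars ℝ) (curve 0)).comp_hasDerivAt 0 hcurve
    rw [hconst] at hcomp
    exact hcomp.unique (hasDerivAt_const 0 (f w))
  refine ContinuousLinearMap.ext fun v => ?_
  let c : ι → ℂ := fun j => v j / (Complex.I * w j)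
  have hv : v = (fun j => (c j).re * Complex.I * w j) +
      Complex.I • fun j => (c j).im * Complex.I * w j := by
    ext j
    calc v j = ((c j).re + (c j).im * Complex.I) * (Complex.I * w j) := by
          rw [Complex.re_add_im, div_mul_cancel₀ _ (mul_ne_zero Complex.I_ne_zero (hw j))]
      _ = _ := by
          simp only [Pi.add_apply, Pi.smul_apply, smul_eq_mul]
          ring
  rw [hv, map_add, map_smul, hreal, hreal, smul_zero, add_zero, zero_apply]

variable {n : ℕ} {G : Set (Fin n → ℂ)} {f : (Fin n → ℂ) → ℂ}

theorem IsCircled.rotate_mem (hG : IsCircled G) {z : Fin n → ℂ} (hz : z ∈ G)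
    (t : UnitAddTorus (Fin n)) : rotate t z ∈ G := by
  have hexp (c : Circle) : Complex.exp (Complex.I * (c : ℂ).arg) = c := by
    rw [mul_comm, ← Circle.coe_exp, Circle.exp_arg]
  have := hG z hz fun j => ((t j).toCircle : ℂ).arg
  simp only [hexp] at this
  exact this

theorem IsCircled.mem_of_norm_eq (hG : IsCircled G) {z w : Fin n → ℂ} (hz : z ∈ G)
    (h : ∀ j, ‖w j‖ = ‖z j‖) : w ∈ G := by
  obtain ⟨t, rfl⟩ := exists_rotate_eq h
  exact hG.rotate_mem hz t

theorem IsCircled.continuous_comp_rotate (hG : IsCircled G) (hf : ContinuousOn f G)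
    {w : Fin n → ℂ} (hw : w ∈ G) : Continuous fun t => f (rotate t w) :=
  hf.comp_continuous (continuous_rotate.comp (.prodMk_left w)) fun t => hG.rotate_mem hw t

theorem IsCircled.exists_norm_rotate_le (hG : IsCircled G) (hf : ContinuousOn f G)
    {w : Fin n → ℂ} (hw : w ∈ G) : ∃ M, ∀ t, ‖f (rotate t w)‖ ≤ M := by
  obtain ⟨M, hM⟩ := isCompact_univ.exists_bound_of_continuousOn
    (hG.continuous_comp_rotate hf hw).continuousOn
  exact ⟨M, fun t => hM t trivial⟩

/-- `a` is the family of Laurent coefficients of `f` on `G`, that is, the homogeneous component of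
`f` of degree `α` is `a α * z ^ α`. The negative powers are moved to the left-hand side to obtain a
condition which is also meaningful on the coordinate hyperplanes. -/
def IsLaurentCoeff (G : Set (Fin n → ℂ)) (f : (Fin n → ℂ) → ℂ) (a : (Fin n → ℤ) → ℂ) : Prop :=
  ∀ α, ∀ w ∈ G, laurentPart f α w * zmonomial α⁻ w = a α * zmonomial α⁺ w

theorem IsLaurentCoeff.laurentPart_eq {a : (Fin n → ℤ) → ℂ} (ha : IsLaurentCoeff G f a)
    (α : Fin n → ℤ) {w : Fin n → ℂ} (hw : w ∈ G) (hw0 : ∀ j, w j ≠ 0) :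
    laurentPart f α w = a α * zmonomial α w := by
  have := ha α w hw
  rw [← mul_zmonomial_negPart hw0, ← mul_assoc] at this
  exact mul_right_cancel₀ (zmonomial_ne_zero fun j => .inl (hw0 j)) this

theorem exists_laurentPart_eventuallyEq (hGo : IsOpen G) (hG : IsCircled G)
    (hf : DifferentiableOn ℂ f G) (α : Fin n → ℤ) {p : Fin n → ℂ} (hp : p ∈ G)
    (hp0 : ∀ j, p j ≠ 0) :
    ∃ a : ℂ, ∀ᶠ w in 𝓝 p, laurentPart f α w = a * zmonomial α w := by
  have hA := differentiableOn_laurentPart hGo (fun z hz => hG.rotate_mem hz) hf α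
  let B := laurentPart f α / zmonomial α
  obtain ⟨r, hr, hball⟩ := Metric.mem_nhds_iff.1
    ((hGo.eventually_mem hp).and (eventually_forall_ne_zero hp0))
  have hB : ∀ w ∈ ball p r, DifferentiableAt ℂ B w := fun w hw => by
    rw [show B = laurentPart f α * (zmonomial α)⁻¹ from div_eq_mul_inv _ _]
    exact (hA.differentiableAt (hGo.mem_nhds (hball hw).1)).mul <|
      (differentiableAt_zmonomial fun j => .inl ((hball hw).2 j)).inv
      (zmonomial_ne_zero fun j => .inl ((hball hw).2 j))
  have hB' : ∀ w ∈ ball p r, fderiv ℂ B w = 0 := fun w hw => by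
    refine fderiv_eq_zero_of_forall_norm_eq (hB w hw) (hball hw).2 fun z hz => ?_
    obtain ⟨t, rfl⟩ := exists_rotate_eq hz
    have ht : mFourier α t ≠ 0 := by simp [mFourier, Finset.prod_ne_zero_iff]
    simp only [B, Pi.div_apply, laurentPart_rotate, zmonomial_rotate, mul_div_mul_left _ _ ht]
  refine ⟨B p, ?_⟩
  filter_upwards [ball_mem_nhds p hr] with w hw
  have : B w = B p := isOpen_ball.is_const_of_fderiv_eq_zero
    (convex_ball p r).isPreconnected (fun z hz => (hB z hz).differentiableWithinAt) hB' hw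
    (mem_ball_self hr)
  rw [← this]
  exact (div_mul_cancel₀ _ (zmonomial_ne_zero fun j => .inl ((hball hw).2 j))).symm

theorem exists_isLaurentCoeff (hGr : IsRegion G) (hG : IsCircled G)
    (hf : DifferentiableOn ℂ f G) : ∃ a, IsLaurentCoeff G f a := by
  obtain ⟨p, hp, hp0⟩ := exists_mem_forall_ne_zero hGr.1 hGr.2.nonempty
  choose a ha using fun α => exists_laurentPart_eventuallyEq hGr.1 hG hf α hp hp0
  have hpow {γ : Fin n → ℤ} (hγ : 0 ≤ γ) : DifferentiableOn ℂ (zmonomial γ) G := fun w _ =>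
    (differentiableAt_zmonomial fun j => .inr (hγ j)).differentiableWithinAt
  refine ⟨a, fun α => eqOn_of_preconnected_of_eventuallyEq hGr.1 hGr.2.isPreconnected
    ((differentiableOn_laurentPart hGr.1 (fun z hz => hG.rotate_mem hz) hf α).mul
      (hpow (negPart_nonneg α))) ((hpow (posPart_nonneg α)).const_mul (a α)) hp ?_⟩
  filter_upwards [ha α, eventually_forall_ne_zero hp0] with w hw hw0
  rw [hw, mul_assoc, mul_zmonomial_negPart hw0]

theorem IsLaurentCoeff.eq_zero_of_mem_vanishingCoords {a : (Fin n → ℤ) → ℂ}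
    (ha : IsLaurentCoeff G f a) (hGo : IsOpen G) {α : Fin n → ℤ} {j : Fin n}
    (hj : j ∈ vanishingCoords G) (hα : α j < 0) : a α = 0 := by
  obtain ⟨z, hz, hzj⟩ := hj
  have hopen : IsOpen ((fun y : Fin n → ℂ => Function.update y j 0) ⁻¹' G) :=
    hGo.preimage (by fun_prop)
  obtain ⟨y, hyG, hy⟩ := exists_mem_forall_ne_zero hopen
    ⟨z, by rwa [mem_preimage, ← hzj, Function.update_eq_self]⟩
  have hneg : zmonomial α⁻ (Function.update y j 0) = 0 :=
    zmonomial_eq_zero (j := j) (Function.update_self ..)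
      (by rw [Pi.negPart_apply, negPart_of_nonpos hα.le]; omega)
  have hpos : zmonomial α⁺ (Function.update y j 0) ≠ 0 := by
    refine zmonomial_ne_zero fun i => ?_
    rcases eq_or_ne i j with rfl | hij
    · exact .inr (by rw [Pi.posPart_apply, posPart_of_nonpos hα.le])
    · exact .inl (by rw [Function.update_of_ne hij]; exact hy i)
  have := ha α _ hyG
  rw [hneg, mul_zero, eq_comm] at this
  exact (mul_eq_zero.1 this).resolve_right hpos

end Torus

section Abel

variable {ι : Type*} [Fintype ι]

theorem summable_prod_pi {κ : ι → Type*} {g : ∀ i, κ i → ℝ} (hg0 : ∀ i k, 0 ≤ g i k)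
    (hg : ∀ i, Summable (g i)) : Summable fun p : ∀ i, κ i => ∏ i, g i (p i) := by
  classical
  refine summable_of_sum_le (c := ∏ i, ∑' k, g i k)
    (fun p => Finset.prod_nonneg fun i _ => hg0 i (p i)) fun s => ?_
  let box : ∀ i, Finset (κ i) := fun i => s.image (· i)
  calc ∑ p ∈ s, ∏ i, g i (p i) ≤ ∑ p ∈ Fintype.piFinset box, ∏ i, g i (p i) :=
        Finset.sum_le_sum_of_subset_of_nonneg
          (fun p hp => Fintype.mem_piFinset.2 fun i => Finset.mem_image_of_mem _ hp)
          fun p _ _ => Finset.prod_nonneg fun i _ => hg0 i (p i)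
    _ = ∏ i, ∑ k ∈ box i, g i k := (Finset.prod_univ_sum box g).symm
    _ ≤ ∏ i, ∑' k, g i k :=
        Finset.prod_le_prod (fun i _ => Finset.sum_nonneg fun k _ => hg0 i k)
          fun i _ => (hg i).sum_le_tsum _ fun k _ => hg0 i k

theorem summable_exp_neg_mul_sum_abs {δ : ℝ} (hδ : 0 < δ) :
    Summable fun α : ι → ℤ => Real.exp (-(δ * ∑ j, |(α j : ℝ)|)) := by
  have hnat : Summable fun k : ℕ => Real.exp (-(δ * k)) :=
    (Real.summable_exp_nat_mul_iff.2 (neg_lt_zero.2 hδ)).congr fun k => by ring_nf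
  have hint : Summable fun k : ℤ => Real.exp (-(δ * |(k : ℝ)|)) :=
    .of_nat_of_neg (by simpa using hnat) (by simpa using hnat)
  refine (summable_prod_pi (fun _ k => (Real.exp_pos _).le) fun _ : ι => hint).congr fun α => ?_
  rw [← Real.exp_sum, Finset.mul_sum, Finset.sum_neg_distrib]

/-- The logarithms of the moduli at which the terms of the Laurent series with coefficients `a` are
bounded. By Abel's lemma, the series converges locally uniformly on the interior. -/
def boundedTerms (a : (ι → ℤ) → ℂ) : Set (ι → ℝ) :=
  {x | BddAbove (range fun α => ‖a α‖ * Real.exp (∑ j, α j * x j))}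

theorem convex_boundedTerms (a : (ι → ℤ) → ℂ) : Convex ℝ (boundedTerms a) := by
  rintro x ⟨M, hM⟩ y ⟨N, hN⟩ s t hs ht hst
  refine ⟨max M N, ?_⟩
  rintro _ ⟨α, rfl⟩
  let dot : (ι → ℝ) →ₗ[ℝ] ℝ := ∑ j, (α j : ℝ) • LinearMap.proj j
  have hconv : ConvexOn ℝ univ fun x : ι → ℝ => ‖a α‖ * Real.exp (∑ j, α j * x j) := by
    have := (convexOn_exp.comp_linearMap dot).smul (norm_nonneg (a α))
    simpa [dot, Function.comp_def] using this
  have hle := hconv.convex_le (max M N)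
  exact (hle ⟨mem_univ x, (hM ⟨α, rfl⟩).trans (le_max_left M N)⟩
    ⟨mem_univ y, (hN ⟨α, rfl⟩).trans (le_max_right M N)⟩ hs ht hst).2

theorem sum_mul_le_sum_mul_add_sign {x y : ι → ℝ} {δ : ℝ} (hxy : ∀ j, |y j - x j| ≤ δ)
    (α : ι → ℝ) :
    ∑ j, α j * y j ≤ ∑ j, α j * (x j + 2 * δ * SignType.sign (α j)) + -(δ * ∑ j, |α j|) := by
  rw [Finset.mul_sum, ← Finset.sum_neg_distrib, ← Finset.sum_add_distrib]
  refine Finset.sum_le_sum fun j _ => ?_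
  have hsign : α j * SignType.sign (α j) = |α j| := self_mul_sign (α j)
  have hle : α j * (y j - x j) ≤ |α j| * δ :=
    (le_abs_self _).trans (by rw [abs_mul]; gcongr; exact hxy j)
  linear_combination hle - 2 * δ * hsign

/-- Abel's lemma: compare the terms at `y` near `x` with those at the corners `x + 2 δ ε`, where
`ε` is the vector of signs of the exponent. -/
theorem exists_summable_bound {a : (ι → ℤ) → ℂ} {x : ι → ℝ} (hx : boundedTerms a ∈ 𝓝 x) :
    ∃ u : (ι → ℤ) → ℝ, Summable u ∧
      ∀ᶠ y in 𝓝 x, ∀ α, ‖a α‖ * Real.exp (∑ j, α j * y j) ≤ u α := by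
  obtain ⟨r, hr, hball⟩ := Metric.mem_nhds_iff.1 hx
  obtain ⟨δ, hδ, hδr⟩ : ∃ δ : ℝ, 0 < δ ∧ 2 * δ < r := ⟨r / 4, by linarith, by linarith⟩
  let corner : (ι → SignType) → ι → ℝ := fun ε j => x j + 2 * δ * ε j
  have hcorner (ε : ι → SignType) : corner ε ∈ boundedTerms a := by
    refine hball ((dist_pi_lt_iff hr).2 fun j => ?_)
    have hε : |(ε j : ℝ)| ≤ 1 := by cases ε j <;> simp
    rw [Real.dist_eq, add_sub_cancel_left, abs_mul, abs_of_pos (by positivity)]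
    nlinarith
  choose M hM using hcorner
  obtain ⟨B, hB⟩ := Finite.bddAbove_range M
  refine ⟨fun α => B * Real.exp (-(δ * ∑ j, |(α j : ℝ)|)),
    (summable_exp_neg_mul_sum_abs hδ).mul_left _, ?_⟩
  filter_upwards [ball_mem_nhds x hδ] with y hy α
  let ε : ι → SignType := fun j => SignType.sign (α j : ℝ)
  have hdist (j : ι) : |y j - x j| ≤ δ := (dist_le_pi_dist y x j).trans (mem_ball.1 hy).le
  calc ‖a α‖ * Real.exp (∑ j, α j * y j)
      ≤ ‖a α‖ * Real.exp (∑ j, α j * corner ε j + -(δ * ∑ j, |(α j : ℝ)|)) := by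
        gcongr
        exact sum_mul_le_sum_mul_add_sign hdist fun j => (α j : ℝ)
    _ = ‖a α‖ * Real.exp (∑ j, α j * corner ε j) * Real.exp (-(δ * ∑ j, |(α j : ℝ)|)) := by
        rw [Real.exp_add, mul_assoc]
    _ ≤ B * Real.exp (-(δ * ∑ j, |(α j : ℝ)|)) := by
        gcongr
        exact (hM ε ⟨α, rfl⟩).trans (hB ⟨ε, rfl⟩)

end Abel

section LogImage

open scoped Pointwise

section Defs

variable {ι : Type*}

/-- The logarithmic image of a circled set, with the moduli of the coordinates parametrized by the
exponential function. -/
def logImage (G : Set (ι → ℂ)) : Set (ι → ℝ) :=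
  {x | (fun j => (Real.exp (x j) : ℂ)) ∈ G}

/-- The convex hull of the logarithmic image, completed in the negative directions of the
coordinates which vanish somewhere on `G`; it describes the domain of convergence of the Laurent
series of functions on a circled domain `G`. -/
def logHull (G : Set (ι → ℂ)) : Set (ι → ℝ) :=
  convexHull ℝ (logImage G) + {s | ∀ j, s j ≤ 0 ∧ (j ∉ vanishingCoords G → s j = 0)}

/-- The open subset of `(ℂ∖0)ⁿ` with logarithmic image `C`. -/
def tube (C : Set (ι → ℝ)) : Set (ι → ℂ) := {z | (∀ j, z j ≠ 0) ∧ logNorm z ∈ C}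

theorem logNorm_ofReal_exp (x : ι → ℝ) : logNorm (fun j => (Real.exp (x j) : ℂ)) = x := by
  ext j
  simp [logNorm, Complex.norm_exp]

theorem ofReal_exp_ne_zero (x : ι → ℝ) (j : ι) : (fun j => (Real.exp (x j) : ℂ)) j ≠ 0 :=
  Complex.ofReal_ne_zero.2 (Real.exp_ne_zero _)

theorem isOpen_logImage {G : Set (ι → ℂ)} (hG : IsOpen G) : IsOpen (logImage G) :=
  hG.preimage (by fun_prop)

theorem logImage_subset_logHull (G : Set (ι → ℂ)) : logImage G ⊆ logHull G := fun x hx =>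
  ⟨x, subset_convexHull _ _ hx, 0, by simp, by simp⟩

theorem isOpen_logHull {G : Set (ι → ℂ)} (hG : IsOpen G) : IsOpen (logHull G) :=
  (isOpen_logImage hG).convexHull.add_right

theorem convex_logHull (G : Set (ι → ℂ)) : Convex ℝ (logHull G) := by
  refine (convex_convexHull ℝ _).add fun x hx y hy s t hs ht _ j => ⟨?_, fun hj => ?_⟩
  · have hsx := mul_nonpos_of_nonneg_of_nonpos hs (hx j).1
    have hty := mul_nonpos_of_nonneg_of_nonpos ht (hy j).1
    simpa using add_nonpos hsx hty
  · simp [(hx j).2 hj, (hy j).2 hj]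

theorem tube_mem_nhds [Finite ι] {C : Set (ι → ℝ)} {z : ι → ℂ} (hz : ∀ j, z j ≠ 0)
    (hC : C ∈ 𝓝 (logNorm z)) : tube C ∈ 𝓝 z :=
  (eventually_forall_ne_zero hz).and (continuousAt_logNorm hz hC)

theorem isOpen_tube [Finite ι] {C : Set (ι → ℝ)} (hC : IsOpen C) : IsOpen (tube C) :=
  isOpen_iff_mem_nhds.2 fun _ hz => tube_mem_nhds hz.1 (hC.mem_nhds hz.2)

theorem isConnected_tube {C : Set (ι → ℝ)} (hC : IsConnected C) : IsConnected (tube C) := by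
  let polar : (ι → ℝ) × (ι → ℝ) → ι → ℂ := fun p j => Complex.exp (p.1 j + p.2 j * Complex.I)
  have himage : tube C = polar '' (C ×ˢ univ) := by
    ext z
    constructor
    · rintro ⟨hz, hzC⟩
      refine ⟨(logNorm z, fun j => (z j).arg), ⟨hzC, trivial⟩, funext fun j => ?_⟩
      simp only [polar, logNorm, Complex.exp_add, ← Complex.ofReal_exp,
        Real.exp_log (norm_pos_iff.2 (hz j)), Complex.norm_mul_exp_arg_mul_I]
    · rintro ⟨⟨x, y⟩, ⟨hx, -⟩, rfl⟩
      refine ⟨fun j => Complex.exp_ne_zero _, ?_⟩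
      convert hx using 1
      ext j
      simp [polar, logNorm, Complex.norm_exp]
  rw [himage]
  exact (hC.prod isConnected_univ).image polar (by fun_prop)

end Defs

variable {n : ℕ} {G : Set (Fin n → ℂ)}

theorem IsCircled.logNorm_mem_logImage_iff (hG : IsCircled G) {z : Fin n → ℂ}
    (hz : ∀ j, z j ≠ 0) : logNorm z ∈ logImage G ↔ z ∈ G := by
  have hnorm (j : Fin n) : ‖(Real.exp (logNorm z j) : ℂ)‖ = ‖z j‖ := by
    rw [Complex.norm_real, Real.norm_of_nonneg (Real.exp_pos _).le, logNorm,
      Real.exp_log (norm_pos_iff.2 (hz j))]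
  exact ⟨fun h => hG.mem_of_norm_eq h fun j => (hnorm j).symm, fun h => hG.mem_of_norm_eq h hnorm⟩

theorem IsLaurentCoeff.logImage_subset_boundedTerms {f : (Fin n → ℂ) → ℂ} {a : (Fin n → ℤ) → ℂ}
    (ha : IsLaurentCoeff G f a) (hG : IsCircled G) (hf : ContinuousOn f G) :
    logImage G ⊆ boundedTerms a := by
  intro x hx
  obtain ⟨M, hM⟩ := hG.exists_norm_rotate_le hf hx
  refine ⟨M, ?_⟩
  rintro _ ⟨α, rfl⟩
  have := norm_laurentPart_le hM α
  rwa [ha.laurentPart_eq α hx (ofReal_exp_ne_zero x), norm_mul,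
    norm_zmonomial (ofReal_exp_ne_zero x), logNorm_ofReal_exp] at this

theorem IsLaurentCoeff.logHull_subset_boundedTerms {f : (Fin n → ℂ) → ℂ} {a : (Fin n → ℤ) → ℂ}
    (ha : IsLaurentCoeff G f a) (hGo : IsOpen G) (hG : IsCircled G) (hf : ContinuousOn f G) :
    logHull G ⊆ boundedTerms a := by
  rintro _ ⟨x, hx, s, hs, rfl⟩
  obtain ⟨M, hM⟩ := convexHull_min (ha.logImage_subset_boundedTerms hG hf)
    (convex_boundedTerms a) hx
  refine ⟨M, ?_⟩
  rintro _ ⟨α, rfl⟩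
  refine le_trans ?_ (hM ⟨α, rfl⟩)
  rcases eq_or_ne (a α) 0 with h0 | h0
  · simp [h0]
  refine mul_le_mul_of_nonneg_left
    (Real.exp_le_exp.2 (Finset.sum_le_sum fun j _ => ?_)) (norm_nonneg _)
  by_cases hj : j ∈ vanishingCoords G
  · have hα : 0 ≤ α j := not_lt.1 fun hlt => h0 (ha.eq_zero_of_mem_vanishingCoords hGo hj hlt)
    have : (α j : ℝ) * s j ≤ 0 :=
      mul_nonpos_of_nonneg_of_nonpos (by exact_mod_cast hα) (hs j).1
    change (α j : ℝ) * (x j + s j) ≤ α j * x j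
    linarith [mul_add (α j : ℝ) (x j) (s j)]
  · simp [(hs j).2 hj]

theorem exists_differentiableOn_tube_logHull (hGr : IsRegion G) (hG : IsCircled G)
    {f : (Fin n → ℂ) → ℂ} (hf : DifferentiableOn ℂ f G) :
    ∃ f', DifferentiableOn ℂ f' (tube (logHull G)) ∧ EqOn f' f (G ∩ tube (logHull G)) := by
  obtain ⟨a, ha⟩ := exists_isLaurentCoeff hGr hG hf
  have hbound : ∀ z ∈ tube (logHull G), ∃ u : (Fin n → ℤ) → ℝ, Summable u ∧
      ∀ᶠ w in 𝓝 z, (∀ j, w j ≠ 0) ∧ ∀ α, ‖a α * zmonomial α w‖ ≤ u α := by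
    intro z hz
    obtain ⟨u, hu, hau⟩ := exists_summable_bound (mem_of_superset
      ((isOpen_logHull hGr.1).mem_nhds hz.2)
      (ha.logHull_subset_boundedTerms hGr.1 hG hf.continuousOn))
    refine ⟨u, hu, ?_⟩
    filter_upwards [eventually_forall_ne_zero hz.1, (continuousAt_logNorm hz.1).eventually hau]
      with w hw hwu
    exact ⟨hw, fun α => by simpa only [norm_mul, norm_zmonomial hw] using hwu α⟩
  refine ⟨fun z => ∑' α, a α * zmonomial α z, fun z hz => ?_, fun w ⟨hwG, hwT⟩ => ?_⟩
  · obtain ⟨u, hu, hz⟩ := hbound z hz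
    obtain ⟨r, hr, hball⟩ := Metric.mem_nhds_iff.1 hz
    exact ((differentiableOn_tsum_of_summable_norm hu isOpen_ball
      (fun α w hw => ((differentiableAt_zmonomial fun j => .inl ((hball hw).1 j)).const_mul
        _).differentiableWithinAt) fun α w hw => (hball hw).2 α).differentiableAt
      (ball_mem_nhds z hr)).differentiableWithinAt
  · obtain ⟨u, hu, hw⟩ := hbound w hwT
    have hterm (α : Fin n → ℤ) : laurentPart f α w = a α * zmonomial α w :=
      ha.laurentPart_eq α hwG hwT.1
    have hsum := hasSum_laurentPart (hG.continuous_comp_rotate hf.continuousOn hwG)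
      (.of_norm_bounded hu fun α => by simpa only [hterm] using hw.self_of_nhds.2 α)
    simpa only [hterm] using hsum.tsum_eq

theorem logHull_subset_logImage (hG : IsCircled G) (hhol : IsDomainOfHolomorphy G) :
    logHull G ⊆ logImage G := by
  obtain ⟨hGr, hmax⟩ := hhol
  obtain ⟨p, hpG, hp⟩ := exists_mem_forall_ne_zero hGr.1 hGr.2.nonempty
  have hpL : logNorm p ∈ logHull G :=
    logImage_subset_logHull G ((hG.logNorm_mem_logImage_iff hp).2 hpG)
  have hTr : IsRegion (tube (logHull G)) := ⟨isOpen_tube (isOpen_logHull hGr.1),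
    isConnected_tube ⟨⟨_, hpL⟩, (convex_logHull G).isPreconnected⟩⟩
  obtain ⟨r, hr, hball⟩ := Metric.isOpen_iff.1 (hGr.1.inter hTr.1) p ⟨hpG, hp, hpL⟩
  have hsub : tube (logHull G) ⊆ G := by
    by_contra hnot
    refine hmax ⟨ball p r, tube (logHull G), ⟨isOpen_ball, isConnected_ball hr⟩, hTr, hball,
      hnot, fun f hf => ?_⟩
    obtain ⟨f', hf', heq⟩ := exists_differentiableOn_tube_logHull hGr hG hf
    exact ⟨f', hf', heq.mono hball⟩
  intro x hx
  exact hsub ⟨ofReal_exp_ne_zero x, by rwa [logNorm_ofReal_exp]⟩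

end LogImage

section BoundarySmooth

variable {n : ℕ} {G : Set (Fin n → ℂ)} {f g : (Fin n → ℂ) → ℂ} {k m : ℕ}

/-- `f` is holomorphic on `G` and extends continuously to the closure of `G`. -/
def ExtendsContinuously (G : Set (Fin n → ℂ)) (f : (Fin n → ℂ) → ℂ) : Prop :=
  DifferentiableOn ℂ f G ∧ ∃ g, ContinuousOn g (closure G) ∧ EqOn g f G

/-- All iterated partial derivatives of `f` of order at most `k` are holomorphic on `G` and extend
continuously to the closure. In contrast to `spaceA`, the derivatives may be taken in any order,
which makes the notion recursive in `k`. -/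
def BoundarySmooth (G : Set (Fin n → ℂ)) : ℕ → ((Fin n → ℂ) → ℂ) → Prop
  | 0, f => ExtendsContinuously G f
  | k + 1, f => ExtendsContinuously G f ∧ ∀ j, BoundarySmooth G k (partialDeriv j f)

theorem partialDeriv_eq_fderiv {z : Fin n → ℂ} (hf : DifferentiableAt ℂ f z) (j : Fin n) :
    partialDeriv j f z = fderiv ℂ f z (Pi.single j 1) :=
  hf.lineDeriv_eq_fderiv

theorem eqOn_partialDeriv (hG : IsOpen G) (h : EqOn f g G) (j : Fin n) :
    EqOn (partialDeriv j f) (partialDeriv j g) G := fun _ hz =>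
  (h.eventuallyEq_of_mem (hG.mem_nhds hz)).lineDeriv_eq

namespace ExtendsContinuously

theorem congr (hf : ExtendsContinuously G f) (h : EqOn g f G) : ExtendsContinuously G g :=
  ⟨hf.1.congr h, hf.2.imp fun _ he => ⟨he.1, he.2.trans h.symm⟩⟩

theorem const (G : Set (Fin n → ℂ)) (c : ℂ) : ExtendsContinuously G fun _ => c :=
  ⟨differentiableOn_const c, fun _ => c, continuousOn_const, eqOn_refl _ _⟩

theorem add (hf : ExtendsContinuously G f) (hg : ExtendsContinuously G g) :
    ExtendsContinuously G fun z => f z + g z := by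
  obtain ⟨hf', e, he, hef⟩ := hf
  obtain ⟨hg', d, hd, hdg⟩ := hg
  exact ⟨hf'.fun_add hg', _, he.fun_add hd, fun z hz => congrArg₂ (· + ·) (hef hz) (hdg hz)⟩

theorem mul (hf : ExtendsContinuously G f) (hg : ExtendsContinuously G g) :
    ExtendsContinuously G fun z => f z * g z := by
  obtain ⟨hf', e, he, hef⟩ := hf
  obtain ⟨hg', d, hd, hdg⟩ := hg
  exact ⟨hf'.fun_mul hg', _, he.fun_mul hd, fun z hz => congrArg₂ (· * ·) (hef hz) (hdg hz)⟩

theorem inv (hf : ExtendsContinuously G f) {c : ℝ} (hc : 0 < c) (hfc : ∀ z ∈ G, c ≤ ‖f z‖) :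
    ExtendsContinuously G fun z => (f z)⁻¹ := by
  obtain ⟨hf', e, he, hef⟩ := hf
  have hec : ∀ z ∈ closure G, c ≤ ‖e z‖ := fun z hz =>
    le_on_closure (f := fun _ => c) (fun w hw => (hfc w hw).trans_eq (by rw [hef hw]))
      continuousOn_const he.norm hz
  exact ⟨hf'.fun_inv fun z hz => norm_pos_iff.1 (hc.trans_le (hfc z hz)), _,
    he.fun_inv₀ fun z hz => norm_pos_iff.1 (hc.trans_le (hec z hz)),
    fun z hz => congrArg (·⁻¹) (hef hz)⟩

end ExtendsContinuously

namespace BoundarySmooth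

theorem extendsContinuously (hf : BoundarySmooth G k f) : ExtendsContinuously G f := by
  cases k with
  | zero => exact hf
  | succ k => exact hf.1

theorem differentiableAt (hf : BoundarySmooth G k f) (hG : IsOpen G) {z : Fin n → ℂ}
    (hz : z ∈ G) : DifferentiableAt ℂ f z :=
  hf.extendsContinuously.1.differentiableAt (hG.mem_nhds hz)

theorem of_succ (hf : BoundarySmooth G (k + 1) f) : BoundarySmooth G k f := by
  induction k generalizing f with
  | zero => exact hf.1
  | succ k ih => exact ⟨hf.1, fun j => ih (hf.2 j)⟩

theorem congr (hG : IsOpen G) (hf : BoundarySmooth G k f) (h : EqOn g f G) :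
    BoundarySmooth G k g := by
  induction k generalizing f g with
  | zero => exact ExtendsContinuously.congr hf h
  | succ k ih => exact ⟨hf.1.congr h, fun j => ih (hf.2 j) (eqOn_partialDeriv hG h j)⟩

theorem const (G : Set (Fin n → ℂ)) (k : ℕ) (c : ℂ) : BoundarySmooth G k fun _ => c := by
  induction k generalizing c with
  | zero => exact ExtendsContinuously.const G c
  | succ k ih =>
    have hzero (j : Fin n) : partialDeriv j (fun _ => c) = fun _ => 0 :=
      funext fun z => by simp only [partialDeriv, lineDeriv, deriv_const]
    exact ⟨.const G c, fun j => hzero j ▸ ih 0⟩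

theorem add (hG : IsOpen G) (hf : BoundarySmooth G k f) (hg : BoundarySmooth G k g) :
    BoundarySmooth G k fun z => f z + g z := by
  induction k generalizing f g with
  | zero => exact ExtendsContinuously.add hf hg
  | succ k ih =>
    refine ⟨hf.1.add hg.1, fun j => (ih (hf.2 j) (hg.2 j)).congr hG fun z hz => ?_⟩
    have hfz := hf.differentiableAt hG hz
    have hgz := hg.differentiableAt hG hz
    rw [partialDeriv_eq_fderiv hfz, partialDeriv_eq_fderiv hgz,
      partialDeriv_eq_fderiv (hfz.fun_add hgz), fderiv_fun_add hfz hgz]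
    rfl

theorem sub_const (hG : IsOpen G) (hf : BoundarySmooth G k f) (c : ℂ) :
    BoundarySmooth G k fun z => f z - c := by
  simpa only [sub_eq_add_neg] using add hG hf (.const G k (-c))

theorem mul (hG : IsOpen G) (hf : BoundarySmooth G k f) (hg : BoundarySmooth G k g) :
    BoundarySmooth G k fun z => f z * g z := by
  induction k generalizing f g with
  | zero => exact ExtendsContinuously.mul hf hg
  | succ k ih =>
    refine ⟨hf.1.mul hg.1, fun j => (add hG (ih hf.of_succ (hg.2 j))
      (ih hg.of_succ (hf.2 j))).congr hG fun z hz => ?_⟩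
    have hfz := hf.differentiableAt hG hz
    have hgz := hg.differentiableAt hG hz
    rw [partialDeriv_eq_fderiv hfz, partialDeriv_eq_fderiv hgz,
      partialDeriv_eq_fderiv (hfz.fun_mul hgz), fderiv_fun_mul hfz hgz]
    rfl

theorem inv (hG : IsOpen G) (hf : BoundarySmooth G k f) {c : ℝ} (hc : 0 < c)
    (hfc : ∀ z ∈ G, c ≤ ‖f z‖) : BoundarySmooth G k fun z => (f z)⁻¹ := by
  induction k with
  | zero => exact ExtendsContinuously.inv hf hc hfc
  | succ k ih =>
    have hi := ih hf.of_succ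
    refine ⟨hf.1.inv hc hfc, fun j =>
      (mul hG (.const G k (-1)) (mul hG (hf.2 j) (mul hG hi hi))).congr hG fun z hz => ?_⟩
    have hfz := hf.differentiableAt hG hz
    have hinv : HasFDerivAt (fun w => (f w)⁻¹) _ z :=
      (hasDerivAt_inv (norm_pos_iff.1 (hc.trans_le (hfc z hz)))).comp_hasFDerivAt z hfz.hasFDerivAt
    rw [partialDeriv_eq_fderiv hfz, partialDeriv_eq_fderiv hinv.differentiableAt, hinv.fderiv,
      smul_apply, smul_eq_mul]
    ring

theorem iterate_partialDeriv (hf : BoundarySmooth G (m + k) f) (j : Fin n) :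
    BoundarySmooth G k ((partialDeriv j)^[m] f) := by
  induction m generalizing f with
  | zero => rwa [Nat.zero_add] at hf
  | succ m ih =>
    rw [Nat.add_right_comm] at hf
    exact ih (hf.2 j)

theorem foldr_partialDeriv (ν : Fin n → ℕ) (l : List (Fin n))
    (hf : BoundarySmooth G ((l.map ν).sum + k) f) :
    BoundarySmooth G k (l.foldr (fun j g => (partialDeriv j)^[ν j] g) f) := by
  induction l generalizing k with
  | nil => simpa using hf
  | cons j l ih =>
    refine iterate_partialDeriv (ih ?_) j
    rwa [List.map_cons, List.sum_cons, add_comm (ν j), add_assoc] at hf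

theorem mem_spaceA (hf : BoundarySmooth G k f) : f ∈ spaceA k G := by
  refine ⟨hf.extendsContinuously.1, fun ν hν => ?_⟩
  have hsum : ((List.finRange n).map ν).sum + (k - ∑ j, ν j) = k := by
    rw [← List.ofFn_eq_map, List.sum_ofFn, Nat.add_sub_cancel' hν]
  exact (foldr_partialDeriv ν (List.finRange n) (hsum.symm ▸ hf)).extendsContinuously.2

end BoundarySmooth

end BoundarySmooth

section BoundedExponent

variable {n : ℕ} {G : Set (Fin n → ℂ)} {γ m : Fin n → ℤ}

theorem zmonomial_eq_zpow_mul_prod_erase (α : Fin n → ℤ) (z : Fin n → ℂ) (j : Fin n) :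
    zmonomial α z = z j ^ α j * ∏ i ∈ Finset.univ.erase j, z i ^ α i :=
  (Finset.mul_prod_erase _ _ (Finset.mem_univ j)).symm

theorem partialDeriv_zmonomial {α : Fin n → ℤ} {z : Fin n → ℂ} {j : Fin n}
    (h : z j ≠ 0 ∨ 0 ≤ α j) :
    partialDeriv j (zmonomial α) z = α j * zmonomial (α - Pi.single j 1) z := by
  have hline : (fun t : ℂ => zmonomial α (z + t • Pi.single j 1)) =
      fun t => (z j + t) ^ α j * ∏ i ∈ Finset.univ.erase j, z i ^ α i := by
    ext t
    rw [zmonomial_eq_zpow_mul_prod_erase _ _ j]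
    congr 1
    · simp
    · exact Finset.prod_congr rfl fun i hi => by simp [Finset.ne_of_mem_erase hi]
  have hderiv : HasDerivAt (fun t : ℂ => (z j + t) ^ α j) (α j * z j ^ (α j - 1)) 0 := by
    have hzpow : HasDerivAt (· ^ α j) (α j * z j ^ (α j - 1)) (z j + 0) := by
      simpa only [add_zero] using hasDerivAt_zpow (α j) (z j) h
    exact hzpow.comp_const_add (z j) 0
  rw [partialDeriv, lineDeriv, hline, (hderiv.mul_const _).deriv,
    zmonomial_eq_zpow_mul_prod_erase _ _ j, mul_assoc]
  congr 2
  · simp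
  · exact Finset.prod_congr rfl fun i hi => by simp [Finset.ne_of_mem_erase hi]

/-- The exponents `γ` for which the monomial `z ^ γ` is holomorphic and bounded on `G`. The bound
is only required off the coordinate hyperplanes, where `z ^ γ` has no junk values. -/
def IsBoundedExponent (G : Set (Fin n → ℂ)) (γ : Fin n → ℤ) : Prop :=
  (∀ j ∈ vanishingCoords G, 0 ≤ γ j) ∧
    ∃ C, ∀ z ∈ G, (∀ j, z j ≠ 0) → ‖zmonomial γ z‖ ≤ C

namespace IsBoundedExponent

theorem ne_zero_or_nonneg_add (hγ : IsBoundedExponent G γ) (hm : ∀ j, 0 ≤ m j) {z : Fin n → ℂ}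
    (hz : z ∈ G) (j : Fin n) : z j ≠ 0 ∨ 0 ≤ (γ + m) j :=
  or_iff_not_imp_left.2 fun hj => add_nonneg (hγ.1 j ⟨z, hz, not_not.1 hj⟩) (hm j)

theorem zmonomial_add_eq_zero (hγ : IsBoundedExponent G γ) {z : Fin n → ℂ} {j : Fin n}
    (hz : z ∈ G) (hj : z j = 0) (hm : 0 < m j) : zmonomial (γ + m) z = 0 :=
  zmonomial_eq_zero hj (add_pos_of_nonneg_of_pos (hγ.1 j ⟨z, hz, hj⟩) hm).ne'

theorem exists_norm_zmonomial_le_on_closure (hγ : IsBoundedExponent G γ) :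
    ∃ C, ∀ z ∈ closure G, (∀ j, z j ≠ 0) → ‖zmonomial γ z‖ ≤ C := by
  obtain ⟨-, C, hC⟩ := hγ
  refine ⟨C, fun z hz h0 => le_of_tendsto_of_frequently
    (differentiableAt_zmonomial fun j => .inl (h0 j)).continuousAt.norm
    (((mem_closure_iff_frequently.1 hz).and_eventually (eventually_forall_ne_zero h0)).mono
      fun w hw => hC w hw.1 hw.2)⟩

-- The extension vanishes on the coordinate hyperplanes, where `z ^ m` beats the bounded `z ^ γ`.
theorem extendsContinuously (hγ : IsBoundedExponent G γ) (hm : ∀ j, 0 < m j) :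
    ExtendsContinuously G (zmonomial (γ + m)) := by
  refine ⟨fun z hz => (differentiableAt_zmonomial
    (hγ.ne_zero_or_nonneg_add (fun j => (hm j).le) hz)).differentiableWithinAt,
    fun z => zmonomial γ z * zmonomial m z, fun z _ => ?_, fun z hz => ?_⟩
  · have hmz : ContinuousAt (zmonomial m) z :=
      (differentiableAt_zmonomial fun j => .inr (hm j).le).continuousAt
    by_cases h0 : ∀ j, z j ≠ 0
    · exact ((differentiableAt_zmonomial fun j => .inl (h0 j)).continuousAt.mul
        hmz).continuousWithinAt
    have hm0 {w : Fin n → ℂ} (hw : ¬∀ j, w j ≠ 0) : zmonomial m w = 0 := by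
      push Not at hw
      obtain ⟨j, hj⟩ := hw
      exact zmonomial_eq_zero hj (hm j).ne'
    obtain ⟨C, hC⟩ := hγ.exists_norm_zmonomial_le_on_closure
    rw [ContinuousWithinAt, hm0 h0, mul_zero]
    refine squeeze_zero_norm' (a := fun w => C * ‖zmonomial m w‖)
      (eventually_mem_nhdsWithin.mono fun w hw => ?_) ?_
    · by_cases hw0 : ∀ j, w j ≠ 0
      · rw [norm_mul]
        gcongr
        exact hC w hw hw0
      · simp [hm0 hw0]
    · simpa only [hm0 h0, norm_zero, mul_zero] using
        (hmz.norm.const_mul C).tendsto.mono_left nhdsWithin_le_nhds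
  · by_cases h0 : ∀ j, z j ≠ 0
    · exact (zmonomial_add h0).symm
    push Not at h0
    obtain ⟨j, hj⟩ := h0
    simp only [hγ.zmonomial_add_eq_zero hz hj (hm j), zmonomial_eq_zero hj (hm j).ne', mul_zero]

theorem boundarySmooth (hγ : IsBoundedExponent G γ) (hG : IsOpen G) {k : ℕ}
    (hm : ∀ j, (k : ℤ) < m j) : BoundarySmooth G k (zmonomial (γ + m)) := by
  have hm0 (j : Fin n) : 0 < m j := k.cast_nonneg.trans_lt (hm j)
  induction k generalizing m with
  | zero => exact hγ.extendsContinuously hm0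
  | succ k ih =>
    refine ⟨hγ.extendsContinuously hm0, fun j => ?_⟩
    have hm' (i : Fin n) : (k : ℤ) < (m - Pi.single j 1 : Fin n → ℤ) i := by
      have hi := hm i
      have hle : (Pi.single j 1 : Fin n → ℤ) i ≤ 1 := by
        rw [Pi.single_apply]
        split_ifs <;> decide
      push_cast at hi
      rw [Pi.sub_apply]
      lia
    refine (BoundarySmooth.mul hG (.const G k ((γ + m) j : ℂ))
      (ih hm' fun i => k.cast_nonneg.trans_lt (hm' i))).congr hG fun z hz => ?_
    rw [partialDeriv_zmonomial (hγ.ne_zero_or_nonneg_add (fun i => (hm0 i).le) hz j),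
      add_sub_assoc]

end IsBoundedExponent

end BoundedExponent

section Weight

variable {ι : Type*} [Fintype ι] {α β x : ι → ℝ} {K R : ℝ}

theorem sum_mul_le_sum_mul_add_card_mul (hβα : ∀ j, β j ≤ α j) (hαβ : ∀ j, α j ≤ β j + K)
    (hR : 0 ≤ R) (hx : ∀ j, x j ≤ R) :
    ∑ j, α j * x j ≤ ∑ j, β j * x j + Fintype.card ι * (K * R) := by
  rw [← nsmul_eq_mul, ← Finset.card_univ, ← Finset.sum_const, ← Finset.sum_add_distrib]
  refine Finset.sum_le_sum fun j _ => ?_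
  have hxR := mul_le_mul_of_nonneg_left (hx j) (sub_nonneg.2 (hβα j))
  have hKR := mul_le_mul_of_nonneg_right (sub_le_iff_le_add'.2 (hαβ j)) hR
  linarith

theorem sum_mul_sub_mul_sum_abs_le (hβα : ∀ j, β j ≤ α j) (hαβ : ∀ j, α j ≤ β j + K) :
    ∑ j, β j * x j - K * ∑ j, |x j| ≤ ∑ j, α j * x j := by
  rw [Finset.mul_sum, ← Finset.sum_sub_distrib]
  refine Finset.sum_le_sum fun j _ => ?_
  have hneg := mul_le_mul_of_nonneg_left (neg_abs_le (x j)) (sub_nonneg.2 (hβα j))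
  have hK := mul_le_mul_of_nonneg_right (sub_le_iff_le_add'.2 (hαβ j)) (abs_nonneg (x j))
  linarith

theorem exists_weight_separating {C : Set (ι → ℝ)} (hC : Convex ℝ C) (hx : x ∉ closure C) :
    ∃ (β : ι → ℝ) (u : ℝ), (∀ y ∈ C, ∑ j, β j * y j ≤ u) ∧ u < ∑ j, β j * x j := by
  classical
  obtain ⟨f, u, hf, hfx⟩ := geometric_hahn_banach_closed_point hC.closure isClosed_closure hx
  have hcoord (y : ι → ℝ) : f y = ∑ j, f (fun i => if j = i then 1 else 0) * y j := by
    simpa only [smul_eq_mul, mul_comm, ContinuousLinearMap.coe_coe] using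
      f.toLinearMap.pi_apply_eq_sum_univ y
  exact ⟨_, u, fun y hy => hcoord y ▸ (hf y (subset_closure hy)).le, hcoord x ▸ hfx⟩

theorem nonneg_of_forall_mem_logHull_sum_mul_le {G : Set (ι → ℂ)} {u : ℝ}
    (hne : (logImage G).Nonempty) (hu : ∀ y ∈ logHull G, ∑ j, β j * y j ≤ u) {j : ι}
    (hj : j ∈ vanishingCoords G) : 0 ≤ β j := by
  classical
  by_contra! hlt
  obtain ⟨y, hy⟩ := hne
  have hray (t : ℝ) (ht : 0 ≤ t) : ∑ i, β i * y i + t * -β j ≤ u := by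
    have hmem : y + Pi.single j (-t) ∈ logHull G := by
      refine Set.add_mem_add (subset_convexHull ℝ _ hy) fun i => ?_
      rcases eq_or_ne i j with rfl | hij
      · simp [ht, hj]
      · simp [hij]
    simpa [mul_add, Finset.sum_add_distrib, Pi.single_apply, mul_comm] using hu _ hmem
  obtain ⟨N, hN⟩ := exists_nat_gt ((u - ∑ i, β i * y i) / -β j)
  rw [div_lt_iff₀ (neg_pos.2 hlt)] at hN
  linarith [hray N N.cast_nonneg]

theorem norm_zmonomial_le_exp {α : ι → ℤ} {z : ι → ℂ} {N u : ℝ} (hz : ∀ j, z j ≠ 0) (hN : 0 ≤ N)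
    (hβα : ∀ j, N * β j ≤ α j) (hαβ : ∀ j, α j ≤ N * β j + K) (hR : 0 ≤ R)
    (hzR : ∀ j, logNorm z j ≤ R) (hu : ∑ j, β j * logNorm z j ≤ u) :
    ‖zmonomial α z‖ ≤ Real.exp (N * u + Fintype.card ι * (K * R)) := by
  rw [norm_zmonomial hz, Real.exp_le_exp]
  have hle := sum_mul_le_sum_mul_add_card_mul hβα hαβ hR hzR
  simp only [mul_assoc, ← Finset.mul_sum] at hle
  linarith [mul_le_mul_of_nonneg_left hu hN]

theorem exp_le_norm_zmonomial {α : ι → ℤ} {z : ι → ℂ} {N : ℝ} (hz : ∀ j, z j ≠ 0)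
    (hβα : ∀ j, N * β j ≤ α j) (hαβ : ∀ j, α j ≤ N * β j + K) :
    Real.exp (N * ∑ j, β j * logNorm z j - K * ∑ j, |logNorm z j|) ≤ ‖zmonomial α z‖ := by
  rw [norm_zmonomial hz, Real.exp_le_exp]
  have hle := sum_mul_sub_mul_sum_abs_le (x := logNorm z) hβα hαβ
  simpa only [mul_assoc, ← Finset.mul_sum] using hle

end Weight

section Separation

variable {n : ℕ} {G : Set (Fin n → ℂ)}

theorem IsCircled.closure (hG : IsCircled G) : IsCircled (closure G) := fun _ hz θ =>
  map_mem_closure (by fun_prop) hz fun w hw => hG w hw θ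

theorem IsCircled.logNorm_notMem_closure_logImage (hG : IsCircled G) {z : Fin n → ℂ}
    (hz : ∀ j, z j ≠ 0) (hzG : z ∉ _root_.closure G) :
    logNorm z ∉ _root_.closure (logImage G) := fun h =>
  hzG (hG.closure.mem_of_norm_eq (map_mem_closure
    (f := fun (x : Fin n → ℝ) j => (Real.exp (x j) : ℂ)) (by fun_prop) h fun _ hx => hx)
    fun j => by simp [logNorm, Real.exp_log (norm_pos_iff.2 (hz j))])

theorem exists_logNorm_le (hbdd : Bornology.IsBounded G) :
    ∃ R, 0 ≤ R ∧ ∀ z ∈ G, ∀ j, logNorm z j ≤ R := by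
  obtain ⟨R, hR, hGR⟩ := hbdd.exists_pos_norm_le
  exact ⟨R, hR.le, fun z hz j =>
    (Real.log_le_self (norm_nonneg _)).trans ((norm_le_pi_norm z j).trans (hGR z hz))⟩

theorem exists_weight_separating_logImage (hG : IsCircled G) (hhol : IsDomainOfHolomorphy G)
    {z₀ : Fin n → ℂ} (hz₀ : ∀ j, z₀ j ≠ 0) (hz₀G : z₀ ∉ closure G) :
    ∃ (β : Fin n → ℝ) (u : ℝ), (∀ j ∈ vanishingCoords G, 0 ≤ β j) ∧
      (∀ z ∈ G, (∀ j, z j ≠ 0) → ∑ j, β j * logNorm z j ≤ u) ∧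
      u < ∑ j, β j * logNorm z₀ j := by
  have heq : logHull G = logImage G :=
    (logHull_subset_logImage hG hhol).antisymm (logImage_subset_logHull G)
  obtain ⟨β, u, hu, huz₀⟩ := exists_weight_separating (heq ▸ convex_logHull G)
    (hG.logNorm_notMem_closure_logImage hz₀ hz₀G)
  obtain ⟨p, hpG, hp⟩ := exists_mem_forall_ne_zero hhol.1.1 hhol.1.2.nonempty
  exact ⟨β, u, fun j hj => nonneg_of_forall_mem_logHull_sum_mul_le
      ⟨_, (hG.logNorm_mem_logImage_iff hp).2 hpG⟩ (heq ▸ hu) hj,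
    fun z hz h0 => hu _ ((hG.logNorm_mem_logImage_iff h0).2 hz), huz₀⟩

-- A large multiple `N β` of the separating weight is rounded up to integers; the rounding error
-- stays bounded while the gap grows with `N`.
theorem exists_isBoundedExponent_separating (hbdd : Bornology.IsBounded G) (hG : IsCircled G)
    (hhol : IsDomainOfHolomorphy G) {z₀ : Fin n → ℂ} (hz₀ : ∀ j, z₀ j ≠ 0)
    (hz₀G : z₀ ∉ closure G) (k : ℕ) :
    ∃ γ, IsBoundedExponent G γ ∧ ∃ c < ‖zmonomial (γ + fun _ => (k : ℤ)) z₀‖,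
      ∀ z ∈ G, (∀ j, z j ≠ 0) → ‖zmonomial (γ + fun _ => (k : ℤ)) z‖ ≤ c := by
  obtain ⟨β, u, hβ, hβu, huz₀⟩ := exists_weight_separating_logImage hG hhol hz₀ hz₀G
  obtain ⟨R, hR0, hR⟩ := exists_logNorm_le hbdd
  obtain ⟨N, hN⟩ := exists_nat_gt
    ((k + 1) * (n * R + ∑ j, |logNorm z₀ j|) / (∑ j, β j * logNorm z₀ j - u))
  rw [div_lt_iff₀ (sub_pos.2 huz₀)] at hN
  have hN0 : (0 : ℝ) ≤ N := N.cast_nonneg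
  let γ : Fin n → ℤ := fun j => ⌈N * β j⌉
  let α : Fin n → ℤ := γ + fun _ => (k : ℤ)
  have hγ (j : Fin n) : N * β j ≤ γ j := Int.le_ceil _
  have hγ' (j : Fin n) : γ j ≤ N * β j + 1 := (Int.ceil_lt_add_one _).le
  have hcast (j : Fin n) : (α j : ℝ) = γ j + k := by simp [α]
  have hα (j : Fin n) : N * β j ≤ α j :=
    (hγ j).trans ((le_add_of_nonneg_right k.cast_nonneg).trans_eq (hcast j).symm)
  have hα' (j : Fin n) : α j ≤ N * β j + (k + 1) := by linarith [hγ' j, hcast j]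
  refine ⟨γ, ⟨fun j hj => Int.ceil_nonneg (mul_nonneg hN0 (hβ j hj)), _, fun z hz h0 =>
      norm_zmonomial_le_exp h0 hN0 hγ hγ' hR0 (hR z hz) (hβu z hz h0)⟩,
    _, lt_of_lt_of_le (Real.exp_lt_exp.2 ?_) (exp_le_norm_zmonomial hz₀ hα hα'), fun z hz h0 =>
      norm_zmonomial_le_exp h0 hN0 hα hα' hR0 (hR z hz) (hβu z hz h0)⟩
  rw [Fintype.card_fin]
  linarith

theorem exists_boundarySmooth_zmonomial_separating (hbdd : Bornology.IsBounded G)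
    (hG : IsCircled G) (hhol : IsDomainOfHolomorphy G) {z₀ : Fin n → ℂ} (hz₀ : ∀ j, z₀ j ≠ 0)
    (hz₀G : z₀ ∉ closure G) (k : ℕ) :
    ∃ α, BoundarySmooth G k (zmonomial α) ∧
      ∃ c < ‖zmonomial α z₀‖, ∀ z ∈ G, ‖zmonomial α z‖ ≤ c := by
  obtain ⟨γ, hγ, c, hc, hcG⟩ :=
    exists_isBoundedExponent_separating hbdd hG hhol hz₀ hz₀G (k + 1)
  obtain ⟨p, hpG, hp⟩ := exists_mem_forall_ne_zero hhol.1.1 hhol.1.2.nonempty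
  refine ⟨_, hγ.boundarySmooth hhol.1.1 fun _ => Nat.cast_lt.2 k.lt_succ_self, c, hc,
    fun z hz => ?_⟩
  by_cases h0 : ∀ j, z j ≠ 0
  · exact hcG z hz h0
  push Not at h0
  obtain ⟨j, hj⟩ := h0
  rw [hγ.zmonomial_add_eq_zero hz hj (Nat.cast_pos.2 k.succ_pos), norm_zero]
  exact (norm_nonneg _).trans (hcG p hpG hp)

theorem not_eqOn_inv_zmonomial_sub {G₀ G' : Set (Fin n → ℂ)} (hG' : IsRegion G')
    (hG₀ : IsOpen G₀) (hne : G₀.Nonempty) (hsub : G₀ ⊆ G') {α : Fin n → ℤ} {z₀ : Fin n → ℂ}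
    (hz₀G' : z₀ ∈ G') (hz₀ : ∀ j, z₀ j ≠ 0) (hα : ∀ z ∈ G₀, zmonomial α z ≠ zmonomial α z₀)
    {g : (Fin n → ℂ) → ℂ} (hg : DifferentiableOn ℂ g G') :
    ¬EqOn g (fun z => (zmonomial α z - zmonomial α z₀)⁻¹) G₀ := by
  intro heq
  have hpos : Differentiable ℂ (zmonomial α⁺) := fun z =>
    differentiableAt_zmonomial fun j => .inr (posPart_nonneg α j)
  have hneg : Differentiable ℂ (zmonomial α⁻) := fun z =>
    differentiableAt_zmonomial fun j => .inr (negPart_nonneg α j)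
  obtain ⟨b, hb, hb0⟩ := exists_mem_forall_ne_zero hG₀ hne
  -- Multiplying by `z ^ α⁻` clears the poles of `z ^ α` along the hyperplanes meeting `G'`.
  have hEqOn : EqOn (fun z => g z * (zmonomial α⁺ z - zmonomial α z₀ * zmonomial α⁻ z))
      (zmonomial α⁻) G' := by
    refine eqOn_of_preconnected_of_eventuallyEq hG'.1 hG'.2.isPreconnected
      (hg.fun_mul (hpos.sub (hneg.const_mul _)).differentiableOn) hneg.differentiableOn
      (hsub hb) ?_
    filter_upwards [hG₀.mem_nhds hb, eventually_forall_ne_zero hb0] with z hz hz0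
    rw [heq hz, ← mul_zmonomial_negPart hz0, ← sub_mul,
      inv_mul_cancel_left₀ (sub_ne_zero.2 (hα z hz))]
  have hzero := hEqOn hz₀G'
  simp only [← mul_zmonomial_negPart hz₀, sub_self, mul_zero] at hzero
  exact zmonomial_ne_zero (fun j => .inl (hz₀ j)) hzero.symm

theorem IsFat.nonempty_diff_closure (hG : IsFat G) {U : Set (Fin n → ℂ)} (hU : IsOpen U)
    (hUG : ¬U ⊆ G) : (U \ closure G).Nonempty :=
  sdiff_nonempty.2 fun h => hUG (hG.symm ▸ interior_maximal h hU)

end Separation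

end CircledDomains

open CircledDomains

theorem corollary4 {n : ℕ} (G : Set (Fin n → ℂ))
    (hbdd : Bornology.IsBounded G)
    (hfat : CircledDomains.IsFat G)
    (hcirc : CircledDomains.IsCircled G)
    (hhol : CircledDomains.IsDomainOfHolomorphy G)
    (k : ℕ) :
    CircledDomains.IsDomainOfHolomorphyFor (CircledDomains.spaceA k G) G := by
  refine ⟨hhol.1, ?_⟩
  rintro ⟨G₀, G', hG₀, hG', hsub, hnot, hext⟩
  obtain ⟨z₀, ⟨hz₀G', hz₀G⟩, hz₀⟩ := exists_mem_forall_ne_zero (hG'.1.sdiff isClosed_closure)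
    (hfat.nonempty_diff_closure hG'.1 hnot)
  obtain ⟨α, hα, c, hc, hGc⟩ :=
    exists_boundarySmooth_zmonomial_separating hbdd hcirc hhol hz₀ hz₀G k
  have hlower : ∀ z ∈ G, ‖zmonomial α z₀‖ - c ≤ ‖zmonomial α z - zmonomial α z₀‖ :=
    fun z hz => (sub_le_sub_left (hGc z hz) _).trans
      ((norm_sub_norm_le _ _).trans_eq (norm_sub_rev _ _))
  obtain ⟨g, hg, heq⟩ := hext _
    ((hα.sub_const hhol.1.1 (zmonomial α z₀)).inv hhol.1.1 (sub_pos.2 hc) hlower).mem_spaceA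
  refine not_eqOn_inv_zmonomial_sub hG' hG₀.1 hG₀.2.nonempty (fun z hz => (hsub hz).2) hz₀G' hz₀
    (fun z hz => sub_ne_zero.1 ?_) hg heq
  exact norm_pos_iff.1 ((sub_pos.2 hc).trans_le (hlower z (hsub hz).1))
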